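/- Let $G$ be a finite group of order $n$ with identity $e$, and let $p$ be a probability distribution on $G$. Consider the random walk on $G$ generated by $p$, i.e. the Markov chain $(X_t)_{t\ge 0}$ on $G$ with transition probabilities $P(g,g')=p(g'g^{-1})$, and assume that it is irreducible. Let $\tau_g=\min\{t\ge 0: X_t=g\}$, let $\mathbf{E}_x$ denote expectation for the walk started at $x$, and set $h(g)=\mathbf{E}_e[\tau_g]$. For $f:G\to\mathbb{R}$ and a finite-dimensional complex representation $\rho$ of $G$ put $\hat f(\rho)=\sum_{g\in G}f(g)\rho(g)$. Let $\rho_1,\dots,\rho_r$ be the irreducible complex representations of $G$, each listed exactly once up to isomorphism, with $\rho_1$ the trivial representation, and let $d_i$ be the degree of $\rho_i$. Then: 1. $\mathbf{E}_x[\tau_y]<\infty$ for all $x,y\in G$, and $\mathbf{E}_x[\tau_{gx}]=\mathbf{E}_e[\tau_g]=h(g)$ for all $g,x\in G$. 2. For every $i\neq 1$, the operator $I-\hat p(\rho_i)$ is invertible and $\hat h(\rho_i)=-n\,(I-\hat p(\rho_i))^{-1}$. 3. $\hat h(\rho_1)=-\sum_{i=2}^r d_i\operatorname{Tr}\hat h(\rho_i)$,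 where the $1\times 1$ matrix $\hat h(\rho_1)$ is identified with a scalar. 4. The hitting times are recovered by Fourier inversion: $h(g)=\frac1n\sum_{i=1}^r d_i\operatorname{Tr}\bigl(\rho_i(g^{-1})\,\hat h(\rho_i)\bigr)$ for all $g\in G$. -/

import Mathlib

open MeasureTheory ProbabilityTheory
open scoped ENNReal

noncomputable section

namespace HittingFourier

section MarkovChain

variable {S : Type*}

/-- The transition matrix of the time-homogeneous Markov chain on `S` which moves from `x`
according to the distribution `Q x`. -/
def transitionMatrix (Q : S → PMF S) : Matrix S S ℝ :=
  Matrix.of fun x y => (Q x y).toReal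

variable [Countable S] [MeasurableSpace S] [DiscreteMeasurableSpace S]

/-- One step of the chain, as a Markov kernel. -/
def stepKernel (Q : S → PMF S) : Kernel S S :=
  Kernel.ofFunOfCountable fun x => (Q x).toMeasure

instance (Q : S → PMF S) : IsMarkovKernel (stepKernel Q) :=
  ⟨fun x => by
    change IsProbabilityMeasure (Q x).toMeasure
    infer_instance⟩

/-- The conditional law of the state at time `n + 1` given the states at times `0, …, n`:
it depends only on the state at time `n`. -/
def historyKernel (Q : S → PMF S) (n : ℕ) : Kernel (Finset.Iic n → S) S :=
  (stepKernel Q).comap (fun ω => ω ⟨n, Finset.mem_Iic.2 le_rfl⟩) (measurable_pi_apply _)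

instance (Q : S → PMF S) (n : ℕ) : IsMarkovKernel (historyKernel Q n) := by
  unfold historyKernel
  infer_instance

/-- The law `P_x`, on the space of trajectories `ω = (X₀, X₁, …)`, of the Markov chain with
transition probabilities `Q` and `X₀ = x` (Ionescu-Tulcea). -/
def pathLaw (Q : S → PMF S) (x : S) : Measure (ℕ → S) :=
  Kernel.traj (X := fun _ => S) (historyKernel Q) 0 fun _ => x

/-- The hitting time `τ_y = min {t ≥ 0 : X_t = y}` of a trajectory, infinite if `y` is never
visited. -/
def hitTime (y : S) (ω : ℕ → S) : ℕ∞ :=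
  hittingAfter (fun (t : ℕ) (ω : ℕ → S) => ω t) {y} 0 ω

/-- The expected hitting time `E_x[τ_y]`, as an element of `[0, ∞]`. -/
def expectedHitTime (Q : S → PMF S) (x y : S) : ℝ≥0∞ :=
  ∫⁻ ω, (hitTime y ω : ℝ≥0∞) ∂(pathLaw Q x)

end MarkovChain

section Group

variable {G : Type*} [Group G] [Fintype G]

/-- The transition probabilities `P(g, h) = p(h g⁻¹)` of the random walk on `G` generated
by `p`. -/
def walk (p : PMF G) (g : G) : PMF G :=
  PMF.ofFintype (fun h => p (h * g⁻¹)) (by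
    have h := Equiv.sum_comp (Equiv.mulRight g⁻¹) (p : G → ℝ≥0∞)
    simp only [Equiv.coe_mulRight] at h
    rw [h, ← tsum_fintype (L := .unconditional G)]
    exact p.tsum_coe)

/-- The hitting times `h(g) = E_e[τ_g]` of the random walk generated by `p`. -/
def hit [MeasurableSpace G] [DiscreteMeasurableSpace G] (p : PMF G) (g : G) : ℝ :=
  (expectedHitTime (walk p) 1 g).toReal

/-- The Fourier transform `f̂(ρ) = ∑ g, f(g) ρ(g)` of a real function on `G`. -/
def fourier {V : Type*} [AddCommGroup V] [Module ℂ V] (f : G → ℝ) (ρ : Representation ℂ G V) :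
    Module.End ℂ V :=
  ∑ g, (f g : ℂ) • ρ g

end Group

/-- The family `ρ` lists the irreducible complex representations of the group `G`, each exactly
once up to isomorphism. In `complete` it suffices to look at the spaces `ℂ^d`, because every
irreducible representation of a finite group is finite-dimensional. -/
structure IsIrrepList {G : Type*} [Group G] {ι : Type*} {V : ι → Type*}
    [∀ i, AddCommGroup (V i)] [∀ i, Module ℂ (V i)]
    (ρ : ∀ i, Representation ℂ G (V i)) : Prop where
  irreducible : ∀ i, (ρ i).IsIrreducible
  eq_of_equiv : ∀ i j, Nonempty (Representation.Equiv (ρ i) (ρ j)) → i = j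
  complete : ∀ (d : ℕ) (σ : Representation ℂ G (Fin d → ℂ)), σ.IsIrreducible →
    ∃ i, Nonempty (Representation.Equiv σ (ρ i))

end HittingFourier

end

/-! Condition on the first step and use invariance of the walk under right translation: `h(g) = 1 +
∑ s, p(s) h(g s⁻¹)` for `g ≠ e`. Convolving with a probability distribution preserves total mass, so
the defect `h(g) - ∑ s, p(s) h(g s⁻¹)` sums to zero over `G`. It equals `1` off `e`, hence it is `1
- n δ_e` (`hit_sub_convolution`). For a nontrivial irreducible `ρ` the constant `1` transforms to
zero (`sum_apply_eq_zero`), leaving `ĥ(ρ) (I - p̂(ρ)) = -n I` (`fourier_hit_mul`).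

Inversion (`fourier_inversion`) rests on `∑ i, d_i χ_i = n δ_e`. At `e`, where `h` vanishes, it
determines `ĥ` at the trivial representation.

The subtractions require finite hitting times (`expectedHitTime_ne_top`): by irreducibility, the
probability of avoiding `y` decays geometrically. -/

namespace HittingFourier

/-! ### Hitting times through the chain killed at the target. -/

section KilledChain

variable {S : Type*} [Countable S] [MeasurableSpace S] [DiscreteMeasurableSpace S]

/-- The transition operator of the chain killed when it enters `y`. -/
noncomputable def killedStep (Q : S → PMF S) (y : S) (f : S → ℝ≥0∞) (x : S) : ℝ≥0∞ :=
  ∫⁻ z, ({y}ᶜ : Set S).indicator f z ∂(stepKernel Q x)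

/-- The trajectories which avoid `y` up to time `t`. -/
def avoids (y : S) (t : ℕ) : Set (ℕ → S) := {ω | ∀ i ≤ t, ω i ≠ y}

omit [Countable S] in
lemma measurableSet_avoids (y : S) (t : ℕ) : MeasurableSet (avoids y t) := by
  have : avoids y t = ⋂ i ≤ t, (fun ω : ℕ → S => ω i) ⁻¹' {y}ᶜ := by
    ext ω; simp [avoids]
  rw [this]
  exact MeasurableSet.iInter fun i => MeasurableSet.iInter fun _ =>
    measurable_pi_apply i (MeasurableSet.of_discrete)

lemma stepKernel_apply (Q : S → PMF S) (x : S) : stepKernel Q x = (Q x).toMeasure := rfl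

/-- The Markov property of the path law at time `t`. -/
lemma lintegral_pathLaw_succ (Q : S → PMF S) (x : S) (t : ℕ)
    {F : (Finset.Iic t → S) → ℝ≥0∞} (hF : Measurable F) (g : S → ℝ≥0∞) :
    ∫⁻ ω, F (Preorder.frestrictLe t ω) * g (ω (t + 1)) ∂(pathLaw Q x) =
      ∫⁻ ω, F (Preorder.frestrictLe t ω) * ∫⁻ z, g z ∂(stepKernel Q (ω t)) ∂(pathLaw Q x) := by
  have hg : Measurable g := Measurable.of_discrete
  have key := Kernel.partialTraj_compProd_eq_map_traj (X := fun _ => S)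
    (κ := historyKernel Q) (Nat.zero_le t) (x₀ := fun _ => x)
  have hm : Measurable fun a : (Finset.Iic t → S) × S => F a.1 * g a.2 :=
    (hF.comp measurable_fst).mul (hg.comp measurable_snd)
  have h1 : ∫⁻ ω, F (Preorder.frestrictLe t ω) * g (ω (t + 1)) ∂(pathLaw Q x) =
      ∫⁻ a, F a.1 * g a.2 ∂((pathLaw Q x).map
        (fun ω => ((Preorder.frestrictLe t ω : Finset.Iic t → S), ω (t + 1)))) := by
    rw [lintegral_map hm (by fun_prop)]
  rw [h1, pathLaw, ← key, Measure.lintegral_compProd hm,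
    ← Kernel.traj_map_frestrictLe_apply, lintegral_map hm.lintegral_kernel_prod_right'
      (by fun_prop)]
  refine lintegral_congr fun ω => ?_
  simp only
  rw [lintegral_const_mul _ hg, historyKernel, Kernel.comap_apply]
  rfl

lemma pathLaw_map_zero (Q : S → PMF S) (x : S) :
    (pathLaw Q x).map (fun ω => ω 0) = Measure.dirac x := by
  have h := Kernel.traj_map_frestrictLe_apply (X := fun _ => S) (κ := historyKernel Q) 0 0
    (fun _ => x)
  rw [Kernel.partialTraj_self, Kernel.id_apply] at h
  have h2 : (fun ω : ℕ → S => ω 0) =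
      (fun a : Finset.Iic 0 → S => a ⟨0, by simp⟩) ∘ Preorder.frestrictLe (π := fun _ => S) 0 := rfl
  have hm : Measurable fun a : Finset.Iic 0 → S => a ⟨0, by simp⟩ := measurable_pi_apply _
  rw [h2, ← Measure.map_map hm (by fun_prop), pathLaw, h, Measure.map_dirac' hm]

/-- By the Markov property, each step that avoids `y` contributes one factor of the killed operator.
The outer indicator accounts for time `0`, which `killedStep` does not test. -/
lemma lintegral_avoids (Q : S → PMF S) (x y : S) (t : ℕ) (f : S → ℝ≥0∞) :
    ∫⁻ ω, (avoids y t).indicator 1 ω * f (ω t) ∂(pathLaw Q x) =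
      ({y}ᶜ : Set S).indicator ((killedStep Q y)^[t] f) x := by
  induction t generalizing f with
  | zero =>
    have : ∀ ω : ℕ → S, (avoids y 0).indicator 1 ω * f (ω 0) =
        ({y}ᶜ : Set S).indicator f (ω 0) := by
      intro ω
      by_cases h : ω 0 = y <;> simp [avoids, Set.indicator, h]
    simp_rw [this]
    rw [← lintegral_map (μ := pathLaw Q x) (f := ({y}ᶜ : Set S).indicator f)
      (g := fun ω => ω 0) Measurable.of_discrete (measurable_pi_apply 0), pathLaw_map_zero,
      lintegral_dirac]
    rfl
  | succ t ih =>
    rw [Function.iterate_succ_apply, ← ih]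
    let A : Set (Finset.Iic t → S) := {a | ∀ i, a i ≠ y}
    have hA : MeasurableSet A := by
      have : A = ⋂ i, (fun a : Finset.Iic t → S => a i) ⁻¹' {y}ᶜ := by ext; simp [A]
      rw [this]
      exact MeasurableSet.iInter fun i => measurable_pi_apply i (MeasurableSet.of_discrete)
    have hA1 : ∀ ω : ℕ → S, A.indicator 1 (Preorder.frestrictLe t ω) =
        (avoids y t).indicator (1 : (ℕ → S) → ℝ≥0∞) ω := by
      intro ω
      have : Preorder.frestrictLe t ω ∈ A ↔ ω ∈ avoids y t := by
        simp [A, avoids]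
      by_cases h : ω ∈ avoids y t
      · simp [h, this.2 h]
      · simp [h, mt this.1 h]
    have := lintegral_pathLaw_succ Q x t (F := A.indicator 1)
      (measurable_one.indicator hA) (({y}ᶜ : Set S).indicator f)
    simp_rw [hA1] at this
    unfold killedStep
    rw [← this]
    refine lintegral_congr fun ω => ?_
    have h2 : ω ∈ avoids y (t + 1) ↔ ω ∈ avoids y t ∧ ω (t + 1) ≠ y := by
      simp only [avoids, Set.mem_ofPred_eq, Nat.le_succ_iff]
      constructor
      · exact fun h => ⟨fun i hi => h i (Or.inl hi), h _ (Or.inr rfl)⟩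
      · rintro ⟨h, h'⟩ i (hi | rfl)
        exacts [h i hi, h']
    by_cases h : ω ∈ avoids y t <;> by_cases h' : ω (t + 1) = y <;> simp [Set.indicator, h2, h, h']

omit [Countable S] [MeasurableSpace S] [DiscreteMeasurableSpace S] in
lemma toENNReal_eq_tsum (n : ℕ∞) :
    (n : ℝ≥0∞) = ∑' t : ℕ, ({s : ℕ | (s : ℕ∞) < n}).indicator 1 t := by
  have h : ∀ m : ℕ, ∑' t : ℕ, ({s : ℕ | (s : ℕ∞) < m}).indicator (1 : ℕ → ℝ≥0∞) t = m := by
    intro m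
    rw [tsum_eq_sum (s := Finset.range m) (by intro b hb; simpa using hb)]
    rw [Finset.sum_congr rfl (g := fun _ => (1 : ℝ≥0∞)) (by
      intro b hb
      simpa [Set.indicator] using hb)]
    simp
  induction n using ENat.recTopCoe with
  | top => simp
  | coe m => rw [h]; simp

/-- Tail-sum formula `E τ = ∑ t, P(τ > t)`, where `τ > t` means avoiding `y` up to time `t`. -/
lemma expectedHitTime_eq (Q : S → PMF S) (x y : S) :
    expectedHitTime Q x y =
      ({y}ᶜ : Set S).indicator (fun x => ∑' t, (killedStep Q y)^[t] 1 x) x := by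
  have h : ∀ (t : ℕ) (ω : ℕ → S), (t : ℕ∞) < hitTime y ω ↔ ω ∈ avoids y t := by
    intro t ω
    have := hittingAfter_le_iff (u := fun (t : ℕ) (ω : ℕ → S) => ω t) (s := {y}) (n := 0)
      (i := t) (ω := ω)
    rw [← not_le]
    unfold hitTime
    refine (not_congr this).trans ?_
    simp [avoids]
  unfold expectedHitTime
  simp_rw [toENNReal_eq_tsum (hitTime y _)]
  have h3 : ∀ (t : ℕ) (ω : ℕ → S), ({s : ℕ | (s : ℕ∞) < hitTime y ω}).indicator (1 : ℕ → ℝ≥0∞) t =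
      (avoids y t).indicator 1 ω * (1 : S → ℝ≥0∞) (ω t) := by
    intro t ω
    by_cases h' : ω ∈ avoids y t <;> simp [Set.indicator, h, h']
  simp_rw [h3]
  rw [lintegral_tsum]
  · simp_rw [lintegral_avoids]
    by_cases h' : x = y <;> simp [h']
  · intro t
    simp only [Pi.one_apply, mul_one]
    exact (measurable_one.indicator (measurableSet_avoids y t)).aemeasurable

/-- First-step analysis. At `x = y` the series is the expected return time, so no case distinction
is needed. -/
lemma tsum_killedStep (Q : S → PMF S) (x y : S) :
    ∑' t, (killedStep Q y)^[t] 1 x = 1 + ∫⁻ z, expectedHitTime Q z y ∂(stepKernel Q x) := by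
  rw [tsum_eq_zero_add' ENNReal.summable]
  congr 1
  simp_rw [Function.iterate_succ_apply', expectedHitTime_eq]
  conv_lhs => enter [1, t]; rw [killedStep]
  rw [← lintegral_tsum fun _ => Measurable.of_discrete.aemeasurable]
  refine lintegral_congr fun z => ?_
  by_cases h : z = y <;> simp [h]

lemma expectedHitTime_self (Q : S → PMF S) (y : S) : expectedHitTime Q y y = 0 := by
  simp [expectedHitTime_eq]

lemma expectedHitTime_of_ne (Q : S → PMF S) {x y : S} (h : x ≠ y) :
    expectedHitTime Q x y = 1 + ∫⁻ z, expectedHitTime Q z y ∂(stepKernel Q x) := by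
  rw [expectedHitTime_eq, Set.indicator_of_mem (by simpa using h), tsum_killedStep]

end KilledChain

/-! ### Finiteness of hitting times for an irreducible finite chain. -/

section Finite

variable {S : Type*} [Fintype S] [MeasurableSpace S] [DiscreteMeasurableSpace S]

lemma lintegral_stepKernel (Q : S → PMF S) (x : S) (f : S → ℝ≥0∞) :
    ∫⁻ z, f z ∂(stepKernel Q x) = ∑ z, Q x z * f z := by
  rw [lintegral_fintype]
  refine Finset.sum_congr rfl fun z _ => ?_
  rw [stepKernel_apply, PMF.toMeasure_apply_singleton _ _ (measurableSet_singleton z), mul_comm]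

lemma killedStep_mono (Q : S → PMF S) (y : S) : Monotone (killedStep Q y) := fun _ _ h _ =>
  lintegral_mono fun z => Set.indicator_le_indicator (h z)

lemma killedStep_one_le (Q : S → PMF S) (y : S) : killedStep Q y 1 ≤ 1 := fun x =>
  calc killedStep Q y 1 x ≤ ∫⁻ _, 1 ∂(stepKernel Q x) :=
        lintegral_mono fun z => Set.indicator_le_self _ _ z
    _ = 1 := by simp

lemma killedStep_iterate_antitone (Q : S → PMF S) (y : S) :
    Antitone fun t => (killedStep Q y)^[t] 1 :=
  (killedStep_mono Q y).antitone_iterate_of_map_le (killedStep_one_le Q y)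

lemma killedStep_const_mul (Q : S → PMF S) (y : S) (c : ℝ≥0∞) (f : S → ℝ≥0∞) :
    killedStep Q y (fun x => c * f x) = fun x => c * killedStep Q y f x := by
  funext x
  unfold killedStep
  rw [← lintegral_const_mul _ Measurable.of_discrete]
  refine lintegral_congr fun z => ?_
  by_cases h : z = y <;> simp [h]

lemma killedStep_iterate_const_mul (Q : S → PMF S) (y : S) (c : ℝ≥0∞) (f : S → ℝ≥0∞) (t : ℕ) :
    (killedStep Q y)^[t] (fun x => c * f x) = fun x => c * (killedStep Q y)^[t] f x := by
  induction t with
  | zero => rfl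
  | succ t ih => simp only [Function.iterate_succ_apply', ih, killedStep_const_mul]

omit [MeasurableSpace S] [DiscreteMeasurableSpace S] in
lemma sum_mul_lt_one (q : PMF S) {g : S → ℝ≥0∞} (hg : g ≤ 1) {w : S} (hw : q w ≠ 0)
    (hgw : g w < 1) : ∑ z, q z * g z < 1 := by
  classical
  have hq : ∑ z, q z = 1 := by
    rw [← tsum_fintype (L := .unconditional S)]
    exact q.tsum_coe
  rw [← hq, ← Finset.add_sum_erase _ _ (Finset.mem_univ w),
    ← Finset.add_sum_erase _ (fun z => q z) (Finset.mem_univ w)]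
  refine ENNReal.add_lt_add_of_lt_of_le ?_ ?_ ?_
  · refine ne_top_of_le_ne_top ENNReal.one_ne_top (le_trans ?_ hq.le)
    refine le_trans (Finset.sum_le_sum fun z _ => mul_le_of_le_one_right' (hg z)) ?_
    exact Finset.sum_le_sum_of_subset (Finset.erase_subset _ _)
  · calc q w * g w < q w * 1 := ENNReal.mul_lt_mul_right hw (q.apply_ne_top w) hgw
      _ = q w := mul_one _
  · exact Finset.sum_le_sum fun z _ => mul_le_of_le_one_right' (hg z)

/-- `(killedStep Q y)^[t] 1 x` is the probability of avoiding `y` at times `1, …, t`. The last edge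
of a path to `y` loses mass, and the loss propagates backwards along the path. -/
lemma exists_killedStep_iterate_lt_one (Q : S → PMF S)
    (hQ : (transitionMatrix Q).IsIrreducible) (x y : S) :
    ∃ t, (killedStep Q y)^[t] 1 x < 1 := by
  let : Quiver S := Matrix.toQuiver (transitionMatrix Q)
  have hedge : ∀ {a b : S}, (a ⟶ b) → Q a b ≠ 0 := by
    intro a b e h
    have := e.down
    simp [transitionMatrix, h] at this
  have hle : ∀ t, ({y}ᶜ : Set S).indicator ((killedStep Q y)^[t] 1) ≤ 1 := fun t z =>
    (Set.indicator_le_self _ _ z).trans (killedStep_iterate_antitone Q y (Nat.zero_le t) z)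
  have hpath : ∀ {a b : S}, Quiver.Path a b → (∃ t, (killedStep Q y)^[t] 1 b < 1) →
      ∃ t, (killedStep Q y)^[t] 1 a < 1 := by
    intro a b r
    induction r with
    | nil => exact id
    | cons r e ih =>
      rintro ⟨t, ht⟩
      refine ih ⟨t + 1, ?_⟩
      rw [Function.iterate_succ_apply', killedStep, lintegral_stepKernel]
      exact sum_mul_lt_one _ (hle t) (hedge e) ((Set.indicator_le_self _ _ _).trans_lt ht)
  -- Irreducibility supplies a path of positive length, so a last edge into `y` exists even when `x
  -- = y`.
  obtain ⟨r, hr⟩ := hQ.connected x y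
  obtain ⟨b, r', e, rfl⟩ := Quiver.Path.length_ne_zero_iff_eq_cons r |>.1 hr.ne'
  refine hpath r' ⟨1, ?_⟩
  rw [Function.iterate_one, killedStep, lintegral_stepKernel]
  exact sum_mul_lt_one _ (hle 0) (hedge e) (by simp)

omit [Fintype S] [MeasurableSpace S] [DiscreteMeasurableSpace S] in
-- Each partial sum satisfies `s ≤ N + c * s`. Since it is finite, this rearranges to the uniform
-- bound `s ≤ N / (1 - c)`.
lemma tsum_ne_top_of_contraction {a : ℕ → ℝ≥0∞} (ha : ∀ t, a t ≤ 1) {N : ℕ} {c : ℝ≥0∞}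
    (hc : c < 1) (h : ∀ t, a (t + N) ≤ c * a t) : ∑' t, a t ≠ ⊤ := by
  have hfin : ∀ T, ∑ t ∈ Finset.range T, a t ≤ T := fun T =>
    (Finset.sum_le_sum fun t _ => ha t).trans (by simp)
  have hb : ∀ T, ∑ t ∈ Finset.range T, a t ≤ N / (1 - c) := by
    intro T
    set s := ∑ t ∈ Finset.range T, a t with hs
    have h1 : s ≤ N + c * s := by
      calc s ≤ ∑ t ∈ Finset.range (N + T), a t :=
            Finset.sum_le_sum_of_subset (Finset.range_mono (by omega))
        _ = ∑ t ∈ Finset.range N, a t + ∑ t ∈ Finset.range T, a (N + t) :=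
            Finset.sum_range_add _ _ _
        _ ≤ N + c * s := by
            refine add_le_add (hfin N) ?_
            rw [hs, Finset.mul_sum]
            exact Finset.sum_le_sum fun t _ => by rw [add_comm]; exact h t
    rw [ENNReal.le_div_iff_mul_le (Or.inl (tsub_pos_of_lt hc).ne')
      (Or.inr (ENNReal.natCast_ne_top N)), mul_comm,
      ENNReal.sub_mul fun _ _ => ne_top_of_le_ne_top (ENNReal.natCast_ne_top T) (hfin T), one_mul]
    exact tsub_le_iff_right.2 h1
  rw [ENNReal.tsum_eq_iSup_nat]
  exact ne_top_of_le_ne_top (ENNReal.div_ne_top (ENNReal.natCast_ne_top N)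
    (tsub_pos_of_lt hc).ne') (iSup_le hb)

theorem expectedHitTime_ne_top (Q : S → PMF S) (hQ : (transitionMatrix Q).IsIrreducible)
    (x y : S) : expectedHitTime Q x y ≠ ⊤ := by
  choose T hT using fun x => exists_killedStep_iterate_lt_one Q hQ x y
  have hN : ∀ x, (killedStep Q y)^[Finset.univ.sup T] 1 x < 1 := fun x =>
    (killedStep_iterate_antitone Q y (Finset.le_sup (Finset.mem_univ x)) x).trans_lt (hT x)
  set N := Finset.univ.sup T
  have hc : (Finset.univ.sup fun x => (killedStep Q y)^[N] 1 x) < 1 :=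
    (Finset.sup_lt_iff (by simp)).2 fun x _ => hN x
  set c := Finset.univ.sup fun x => (killedStep Q y)^[N] 1 x with hcdef
  have h := tsum_ne_top_of_contraction (a := fun t => (killedStep Q y)^[t] 1 x) (N := N)
    (fun t => killedStep_iterate_antitone Q y (Nat.zero_le t) x) hc fun t => by
      -- Applying the monotone, homogeneous operator `t` more times to `K^N 1 ≤ c` gives `K^(t+N) 1
      -- ≤ c * K^t 1`, where `K` is `killedStep Q y`.
      have h1 : (killedStep Q y)^[N] 1 ≤ fun x => c * (1 : S → ℝ≥0∞) x := fun z => by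
        simpa using Finset.le_sup (f := fun x => (killedStep Q y)^[N] 1 x) (Finset.mem_univ z)
      have h2 := (killedStep_mono Q y).iterate t h1 x
      rwa [killedStep_iterate_const_mul, ← Function.iterate_add_apply] at h2
  rw [expectedHitTime_eq]
  exact ne_top_of_le_ne_top h (Set.indicator_le_self _ _ _)

end Finite

/-! ### The convolution equation for the walk on the group. -/

section Group

variable {G : Type*} [Group G] [Fintype G] [MeasurableSpace G] [DiscreteMeasurableSpace G]

omit [MeasurableSpace G] [DiscreteMeasurableSpace G] in
lemma walk_apply (p : PMF G) (g h : G) : walk p g h = p (h * g⁻¹) := rfl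

/-- Right translation preserves the transition probabilities: `(w z)(x z)⁻¹ = w x⁻¹`. -/
lemma killedStep_walk_mul_right (p : PMF G) (x y z : G) (f : G → ℝ≥0∞) :
    killedStep (walk p) (y * z) f (x * z) = killedStep (walk p) y (fun w => f (w * z)) x := by
  unfold killedStep
  rw [lintegral_stepKernel, lintegral_stepKernel, ← Equiv.sum_comp (Equiv.mulRight z)]
  refine Finset.sum_congr rfl fun w _ => ?_
  rw [Equiv.coe_mulRight, walk_apply, walk_apply, mul_inv_rev, mul_assoc w, mul_inv_cancel_left]
  by_cases h : w = y <;> simp [h, Set.indicator]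

lemma killedStep_walk_iterate_mul_right (p : PMF G) (x y z : G) (t : ℕ) :
    (killedStep (walk p) (y * z))^[t] 1 (x * z) = (killedStep (walk p) y)^[t] 1 x := by
  induction t generalizing x with
  | zero => rfl
  | succ t ih => simp_rw [Function.iterate_succ_apply', killedStep_walk_mul_right, ih]

theorem expectedHitTime_walk_mul_right (p : PMF G) (x y z : G) :
    expectedHitTime (walk p) (x * z) (y * z) = expectedHitTime (walk p) x y := by
  simp_rw [expectedHitTime_eq]
  by_cases h : x = y <;> simp [h, Set.indicator, killedStep_walk_iterate_mul_right]

lemma hit_one (p : PMF G) : hit p 1 = 0 := by simp [hit, expectedHitTime_self]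

/-- The first-step equation for the hitting times from the identity. -/
lemma hit_of_ne_one (p : PMF G) (hp : (transitionMatrix (walk p)).IsIrreducible) {g : G}
    (hg : g ≠ 1) : hit p g = 1 + ∑ s, (p s).toReal * hit p (g * s⁻¹) := by
  have h : ∀ s, expectedHitTime (walk p) s g = expectedHitTime (walk p) 1 (g * s⁻¹) := fun s => by
    rw [← expectedHitTime_walk_mul_right p 1 (g * s⁻¹) s]
    simp
  have hfin : ∀ s ∈ Finset.univ, p s * expectedHitTime (walk p) 1 (g * s⁻¹) ≠ ⊤ := fun s _ =>
    ENNReal.mul_ne_top (p.apply_ne_top s) (expectedHitTime_ne_top _ hp _ _)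
  unfold hit
  rw [expectedHitTime_of_ne _ hg.symm, lintegral_stepKernel]
  simp_rw [walk_apply, h, inv_one, mul_one]
  rw [ENNReal.toReal_add ENNReal.one_ne_top (ENNReal.sum_ne_top.2 hfin),
    ENNReal.toReal_sum hfin]
  simp [ENNReal.toReal_mul]

/-- The convolution equation satisfied by the hitting times. -/
lemma hit_sub_convolution (p : PMF G) (hp : (transitionMatrix (walk p)).IsIrreducible)
    [DecidableEq G] (g : G) :
    hit p g - ∑ s, (p s).toReal * hit p (g * s⁻¹) =
      1 - if g = 1 then (Fintype.card G : ℝ) else 0 := by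
  have hp1 : ∑ s, (p s).toReal = 1 := by
    rw [← ENNReal.toReal_sum fun s _ => p.apply_ne_top s,
      ← tsum_fintype (L := .unconditional G), p.tsum_coe, ENNReal.toReal_one]
  -- This supplies the value at `1`, where the first-step equation is unavailable: the other `n - 1`
  -- terms equal `1`.
  have htot : ∑ g, (hit p g - ∑ s, (p s).toReal * hit p (g * s⁻¹)) = 0 := by
    rw [Finset.sum_sub_distrib, Finset.sum_comm]
    simp_rw [← Finset.mul_sum]
    have : ∀ s : G, ∑ g, hit p (g * s⁻¹) = ∑ g, hit p g := fun s =>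
      Equiv.sum_comp (Equiv.mulRight s⁻¹) (hit p)
    simp_rw [this, ← Finset.sum_mul, hp1]
    ring
  have hne : ∀ g ≠ (1 : G), hit p g - ∑ s, (p s).toReal * hit p (g * s⁻¹) = 1 := fun g hg => by
    rw [hit_of_ne_one p hp hg]; ring
  by_cases hg : g = 1
  · subst hg
    rw [← Finset.add_sum_erase _ _ (Finset.mem_univ 1), Finset.sum_congr rfl
      (fun g hg => hne g (Finset.ne_of_mem_erase hg))] at htot
    rw [Finset.sum_const, Finset.card_erase_of_mem (Finset.mem_univ _), nsmul_eq_mul,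
      Nat.cast_sub (Finset.card_pos.2 ⟨1, Finset.mem_univ _⟩), Finset.card_univ] at htot
    simp only [if_true]
    push_cast at htot
    linarith
  · rw [hne g hg]; simp [hg]

end Group

open Representation

/-! ### Class functions, completeness of characters and the regular character. -/

section Characters

variable {G : Type*} [Group G] [Fintype G]

/-- The operator `∑ g, F g • σ g` attached to a complex function `F` on the group. -/
noncomputable def funAction {V : Type*} [AddCommGroup V] [Module ℂ V] (F : G → ℂ)
    (σ : Representation ℂ G V) : Module.End ℂ V :=
  ∑ g, F g • σ g

lemma funAction_comm {V : Type*} [AddCommGroup V] [Module ℂ V] {F : G → ℂ}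
    (hF : ∀ g h, F (h * g * h⁻¹) = F g) (σ : Representation ℂ G V) (h : G) :
    funAction F σ * σ h = σ h * funAction F σ := by
  unfold funAction
  rw [Finset.sum_mul, Finset.mul_sum, ← Equiv.sum_comp (MulAut.conj h).toEquiv]
  refine Finset.sum_congr rfl fun g _ => ?_
  have : (MulAut.conj h).toEquiv g = h * g * h⁻¹ := rfl
  rw [this, hF, smul_mul_assoc, mul_smul_comm, ← map_mul, ← map_mul, inv_mul_cancel_right]

/-- A class function acts on an irreducible representation as a scalar. -/
lemma exists_funAction_eq_smul {V : Type*} [AddCommGroup V] [Module ℂ V]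
    [FiniteDimensional ℂ V] {F : G → ℂ} (hF : ∀ g h, F (h * g * h⁻¹) = F g)
    (σ : Representation ℂ G V) [σ.IsIrreducible] :
    ∃ c : ℂ, funAction F σ = c • (1 : Module.End ℂ V) := by
  let f : IntertwiningMap σ σ := ⟨funAction F σ, fun g => funAction_comm hF σ g⟩
  obtain ⟨c, hc⟩ := IsIrreducible.algebraMap_intertwiningMap_bijective_of_isAlgClosed.2 f
  refine ⟨c, ?_⟩
  have := congrArg IntertwiningMap.toLinearMap hc
  rw [show funAction F σ = f.toLinearMap from rfl, ← this]
  rfl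

lemma trace_funAction {V : Type*} [AddCommGroup V] [Module ℂ V]
    (F : G → ℂ) (σ : Representation ℂ G V) :
    LinearMap.trace ℂ V (funAction F σ) = ∑ g, F g * σ.character g := by
  simp [funAction, character]

omit [Fintype G] in
lemma nontrivial_of_isIrreducible {V : Type*} [AddCommGroup V] [Module ℂ V]
    (σ : Representation ℂ G V) [h : σ.IsIrreducible] : Nontrivial V := by
  by_contra hV
  rw [not_nontrivial_iff_subsingleton] at hV
  have : Subsingleton (Subrepresentation σ) :=
    Subrepresentation.toSubmodule_injective.subsingleton
  exact not_subsingleton _ this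

/-- By Schur the operator is a scalar, and its trace is that scalar times a nonzero dimension. -/
lemma funAction_eq_zero_of_trace {V : Type*} [AddCommGroup V] [Module ℂ V]
    [FiniteDimensional ℂ V] {F : G → ℂ} (hF : ∀ g h, F (h * g * h⁻¹) = F g)
    (σ : Representation ℂ G V) [σ.IsIrreducible]
    (h : ∑ g, F g * σ.character g = 0) : funAction F σ = 0 := by
  obtain ⟨c, hc⟩ := exists_funAction_eq_smul hF σ
  have := nontrivial_of_isIrreducible σ
  rw [← trace_funAction, hc, map_smul, LinearMap.trace_one, smul_eq_mul, mul_eq_zero] at h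
  rcases h with h | h
  · rw [hc, h, zero_smul]
  · exact absurd h (Nat.cast_ne_zero.2 Module.finrank_pos.ne')

omit [Fintype G] in
lemma isIrreducible_of_equiv {V W : Type*} [AddCommGroup V] [Module ℂ V]
    [AddCommGroup W] [Module ℂ W] {σ : Representation ℂ G V} {τ : Representation ℂ G W}
    (e : σ.Equiv τ) [hσ : σ.IsIrreducible] : τ.IsIrreducible := by
  rw [irreducible_iff_isSimpleModule_asModule] at hσ ⊢
  let f : τ.asModule →ₗ[MonoidAlgebra ℂ G] σ.asModule :=
    IntertwiningMap.equivLinearMapAsModule τ σ e.symm.toIntertwiningMap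
  exact IsSimpleModule.congr (LinearEquiv.ofBijective f e.symm.toLinearEquiv.bijective)

omit [Fintype G] in
/-- Every finite-dimensional irreducible representation is in the list. -/
lemma IsIrrepList.exists_equiv {ι : Type*} {V : ι → Type*}
    [∀ i, AddCommGroup (V i)] [∀ i, Module ℂ (V i)]
    {ρ : ∀ i, Representation ℂ G (V i)} (hρ : IsIrrepList ρ) {W : Type*} [AddCommGroup W]
    [Module ℂ W] [FiniteDimensional ℂ W] (σ : Representation ℂ G W) [σ.IsIrreducible] :
    ∃ i, Nonempty (σ.Equiv (ρ i)) := by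
  let e : W ≃ₗ[ℂ] (Fin (Module.finrank ℂ W) → ℂ) := (Module.finBasis ℂ W).equivFun
  let τ : Representation ℂ G (Fin (Module.finrank ℂ W) → ℂ) :=
    (e.conjRingEquiv : Module.End ℂ W →* Module.End ℂ (Fin (Module.finrank ℂ W) → ℂ)).comp σ
  let φ : σ.Equiv τ := Representation.Equiv.mk e fun g => by
    ext v
    simp [τ, LinearEquiv.conjRingEquiv]
  have : τ.IsIrreducible := isIrreducible_of_equiv φ
  obtain ⟨i, ⟨ψ⟩⟩ := hρ.complete _ τ this
  exact ⟨i, ⟨φ.trans ψ⟩⟩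

/-- The subrepresentation on which a class function acts as zero. -/
noncomputable def funActionKer {V : Type*} [AddCommGroup V] [Module ℂ V] {F : G → ℂ}
    (hF : ∀ g h, F (h * g * h⁻¹) = F g) (σ : Representation ℂ G V) : Subrepresentation σ where
  toSubmodule := LinearMap.ker (funAction F σ)
  apply_mem_toSubmodule g v hv := by
    rw [LinearMap.mem_ker] at hv ⊢
    rw [← Module.End.mul_apply, funAction_comm hF, Module.End.mul_apply, hv, map_zero]

omit [Fintype G] in
-- Take a nonzero subrepresentation of `U` of minimal dimension.
lemma exists_isIrreducible_le {V : Type*} [AddCommGroup V] [Module ℂ V]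
    [FiniteDimensional ℂ V] (σ : Representation ℂ G V) (U : Subrepresentation σ) (hU : U ≠ ⊥) :
    ∃ A ≤ U, A.toRepresentation.IsIrreducible := by
  let d : Subrepresentation σ → ℕ := fun A => Module.finrank ℂ A.toSubmodule
  obtain ⟨A, ⟨hAU, hA⟩, hmin⟩ := exists_minimalFor_of_wellFoundedLT
    (fun A : Subrepresentation σ => A ≤ U ∧ A ≠ ⊥) d ⟨U, le_rfl, hU⟩
  refine ⟨A, hAU, ?_⟩
  have hbot : A.toSubmodule ≠ ⊥ := fun h => hA (Subrepresentation.toSubmodule_injective h)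
  have : Nontrivial A.toSubmodule := Submodule.nontrivial_iff_ne_bot.2 hbot
  refine { exists_pair_ne := ⟨⊥, ⊤, fun h => ?_⟩, eq_bot_or_eq_top := fun B => ?_ }
  · exact bot_ne_top (α := Submodule ℂ A.toSubmodule)
      (congrArg Subrepresentation.toSubmodule h)
  · let B' : Subrepresentation σ :=
      { toSubmodule := B.toSubmodule.map A.toSubmodule.subtype
        apply_mem_toSubmodule := by
          rintro g _ ⟨b, hb, rfl⟩
          exact ⟨_, B.apply_mem_toSubmodule g hb, rfl⟩ }
    have hB'A : B' ≤ A := Submodule.map_subtype_le _ _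
    have hd : d B' = Module.finrank ℂ B.toSubmodule :=
      Submodule.finrank_map_subtype_eq _ _
    by_cases hB' : B' = ⊥
    · left
      apply Subrepresentation.toSubmodule_injective
      have : B.toSubmodule.map A.toSubmodule.subtype = ⊥ :=
        congrArg Subrepresentation.toSubmodule hB'
      exact Submodule.map_injective_of_injective A.toSubmodule.subtype_injective
        (this.trans (Submodule.map_bot _).symm)
    · right
      apply Subrepresentation.toSubmodule_injective
      refine Submodule.eq_top_of_finrank_eq (le_antisymm (Submodule.finrank_le _) ?_)
      rw [← hd]
      exact hmin ⟨hB'A.trans hAU, hB'⟩ (Submodule.finrank_mono hB'A)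

/-- A class function which acts as zero on every irreducible representation vanishes. -/
lemma eq_zero_of_funAction_eq_zero {ι : Type*} {V : ι → Type*}
    [∀ i, AddCommGroup (V i)] [∀ i, Module ℂ (V i)] [∀ i, FiniteDimensional ℂ (V i)]
    {ρ : ∀ i, Representation ℂ G (V i)} (hρ : IsIrrepList ρ) {F : G → ℂ}
    (hF : ∀ g h, F (h * g * h⁻¹) = F g) (h : ∀ i, ∑ g, F g * (ρ i).character g = 0) : F = 0 := by
  let reg : Representation ℂ G (MonoidAlgebra ℂ G) := leftRegular ℂ G
  have : FiniteDimensional ℂ (MonoidAlgebra ℂ G) := inferInstance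
  -- Maschke gives a complement to the kernel of `F`. If nonzero, it would contain an irreducible,
  -- on which `F` acts as zero, so that irreducible would also lie in the kernel.
  obtain ⟨C, hC⟩ := exists_isCompl (funActionKer hF reg)
  have hC0 : C = ⊥ := by
    by_contra hC0
    obtain ⟨A, hAC, hA⟩ := exists_isIrreducible_le reg C hC0
    obtain ⟨i, ⟨e⟩⟩ := hρ.exists_equiv A.toRepresentation
    have h0 : funAction F A.toRepresentation = 0 :=
      funAction_eq_zero_of_trace hF _ (by rw [char_iso e]; exact h i)
    have hAK : A ≤ funActionKer hF reg := fun v hv => by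
      change funAction F reg v = 0
      have := congrArg Subtype.val (LinearMap.congr_fun h0 ⟨v, hv⟩)
      simpa [funAction, Subrepresentation.toRepresentation] using this
    have : A = ⊥ := le_bot_iff.1 (hC.1 hAK hAC)
    have hn := nontrivial_of_isIrreducible A.toRepresentation
    rw [this] at hn
    obtain ⟨x, hx⟩ := exists_ne (0 : (⊥ : Subrepresentation reg).toSubmodule)
    exact hx (Subtype.ext ((Submodule.mem_bot ℂ).1 x.2))
  have htop : funActionKer hF reg = ⊤ := by
    have := hC.sup_eq_top
    rwa [hC0, sup_bot_eq] at this
  -- Acting on the basis vector at the identity produces `∑ g, F g • g`, whose coefficients are the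
  -- values of `F`.
  have h1 : funAction F reg (MonoidAlgebra.single 1 1) = 0 := by
    have : MonoidAlgebra.single 1 1 ∈ funActionKer hF reg := by rw [htop]; trivial
    exact this
  classical
  funext g
  have := congrArg (fun a => a.coeff g) h1
  simpa [funAction, reg, Finsupp.single_apply] using this

/-- The decomposition of the character of the regular representation. -/
theorem sum_finrank_mul_character {ι : Type*} [Fintype ι] {V : ι → Type*}
    [∀ i, AddCommGroup (V i)] [∀ i, Module ℂ (V i)] [∀ i, FiniteDimensional ℂ (V i)]
    {ρ : ∀ i, Representation ℂ G (V i)} (hρ : IsIrrepList ρ) [DecidableEq G] (g : G) :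
    ∑ i, (Module.finrank ℂ (V i) : ℂ) * (ρ i).character g =
      if g = 1 then (Fintype.card G : ℂ) else 0 := by
  classical
  have := hρ.irreducible
  have hcard : (Nat.card G : ℂ) ≠ 0 := Nat.cast_ne_zero.2 Nat.card_pos.ne'
  let _ : Invertible (Nat.card G : ℂ) := invertibleOfNonzero hcard
  -- The inverse in the character makes the pairing with `χ_j` an orthogonality sum: it equals `n
  -- d_j - d_j n = 0`.
  let F : G → ℂ := fun g => (if g = 1 then (Nat.card G : ℂ) else 0) -
    ∑ i, (Module.finrank ℂ (V i) : ℂ) * (ρ i).character g⁻¹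
  have hF : ∀ g h, F (h * g * h⁻¹) = F g := fun g h => by
    have : (h * g * h⁻¹)⁻¹ = h * g⁻¹ * h⁻¹ := by group
    simp only [F, this, char_conj, conj_eq_one_iff]
  have horth : ∀ i j, ∑ g, (ρ i).character g⁻¹ * (ρ j).character g =
      if i = j then (Nat.card G : ℂ) else 0 := fun i j => by
    have h := char_orthonormal (ρ j) (ρ i)
    rw [inv_mul_eq_iff_eq_mul₀ hcard] at h
    simp_rw [mul_comm ((ρ i).character _), h]
    have : Nonempty ((ρ i).Equiv (ρ j)) ↔ i = j :=
      ⟨hρ.eq_of_equiv i j, fun h => h ▸ ⟨Representation.Equiv.refl _⟩⟩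
    simp [this]
  have hzero : F = 0 := eq_zero_of_funAction_eq_zero hρ hF fun j => by
    simp only [F, sub_mul, Finset.sum_sub_distrib, Finset.sum_mul, ite_mul, zero_mul,
      Finset.sum_ite_eq', Finset.mem_univ, if_true, char_one]
    rw [Finset.sum_comm]
    simp_rw [mul_assoc, ← Finset.mul_sum, horth]
    simp [mul_comm]
  have := congrFun hzero g⁻¹
  simp only [F, inv_inv, inv_eq_one, Pi.zero_apply, sub_eq_zero, Nat.card_eq_fintype_card] at this
  exact this.symm

/-- The group elements sum to zero in a nontrivial irreducible representation. -/
lemma sum_apply_eq_zero {ι : Type*} {V : ι → Type*}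
    [∀ i, AddCommGroup (V i)] [∀ i, Module ℂ (V i)] [∀ i, FiniteDimensional ℂ (V i)]
    {ρ : ∀ i, Representation ℂ G (V i)} (hρ : IsIrrepList ρ) {i i₁ : ι}
    (hi₁ : (ρ i₁).IsTrivial) (hi : i ≠ i₁) : ∑ g, ρ i g = 0 := by
  have := hρ.irreducible
  have hcard : (Nat.card G : ℂ) ≠ 0 := Nat.cast_ne_zero.2 Nat.card_pos.ne'
  let _ : Invertible (Nat.card G : ℂ) := invertibleOfNonzero hcard
  have h := char_orthonormal (ρ i) (ρ i₁)
  rw [if_neg fun ⟨e⟩ => hi (hρ.eq_of_equiv _ _ ⟨e⟩).symm, inv_mul_eq_iff_eq_mul₀ hcard,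
    mul_zero] at h
  have h1 : ∀ g, (ρ i₁).character g = Module.finrank ℂ (V i₁) := fun g => by
    simp [character]
  have hn := nontrivial_of_isIrreducible (ρ i₁)
  simp_rw [h1, ← Finset.sum_mul] at h
  -- The constant `1` is a class function, and orthogonality to the trivial character makes its
  -- trace vanish.
  have h2 := funAction_eq_zero_of_trace (F := fun _ : G => (1 : ℂ)) (fun _ _ => rfl) (ρ i) (by
    simpa using (mul_eq_zero.1 h).resolve_right (Nat.cast_ne_zero.2 Module.finrank_pos.ne'))
  simpa [funAction] using h2

omit [Fintype G] in
-- Under a trivial action every line is invariant.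
lemma finrank_eq_one_of_isTrivial {V : Type*} [AddCommGroup V] [Module ℂ V]
    [FiniteDimensional ℂ V] (σ : Representation ℂ G V) [σ.IsIrreducible] [σ.IsTrivial] :
    Module.finrank ℂ V = 1 := by
  have := nontrivial_of_isIrreducible σ
  obtain ⟨v, hv⟩ := exists_ne (0 : V)
  refine (finrank_eq_one_iff_of_nonzero v hv).2 ?_
  let A : Subrepresentation σ :=
    { toSubmodule := ℂ ∙ v
      apply_mem_toSubmodule := fun g w hw => by simpa using hw }
  rcases eq_bot_or_eq_top A with h | h
  · refine absurd ?_ hv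
    have hm : v ∈ A.toSubmodule := Submodule.mem_span_singleton_self v
    rw [h] at hm
    exact (Submodule.mem_bot ℂ).1 hm
  · exact congrArg Subrepresentation.toSubmodule h

end Characters

/-! ### Fourier transform, inversion and the transformed hitting-time equation. -/

section Transform

variable {G : Type*} [Group G] [Fintype G] {V : Type*} [AddCommGroup V] [Module ℂ V]

/-- The Fourier transform turns convolution into composition. -/
lemma fourier_convolution (f q : G → ℝ) (σ : Representation ℂ G V) :
    fourier (fun g => ∑ s, q s * f (g * s⁻¹)) σ = fourier f σ * fourier q σ := by
  unfold fourier
  simp_rw [Complex.ofReal_sum, Finset.sum_smul, Finset.sum_mul_sum]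
  rw [Finset.sum_comm]
  conv_rhs => rw [Finset.sum_comm]
  refine Finset.sum_congr rfl fun s _ => ?_
  rw [← Equiv.sum_comp (Equiv.mulRight s)]
  refine Finset.sum_congr rfl fun g _ => ?_
  rw [Equiv.coe_mulRight, mul_inv_cancel_right, map_mul, smul_mul_smul_comm, mul_comm (q s),
    Complex.ofReal_mul]

lemma fourier_sub (f q : G → ℝ) (σ : Representation ℂ G V) :
    fourier (fun g => f g - q g) σ = fourier f σ - fourier q σ := by
  simp [fourier, sub_smul]

/-- The Fourier inversion formula. -/
theorem fourier_inversion {ι : Type*} [Fintype ι] {W : ι → Type*}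
    [∀ i, AddCommGroup (W i)] [∀ i, Module ℂ (W i)] [∀ i, FiniteDimensional ℂ (W i)]
    {ρ : ∀ i, Representation ℂ G (W i)} (hρ : IsIrrepList ρ) (f : G → ℝ) (g : G) :
    (f g : ℂ) = (1 / (Fintype.card G : ℂ)) * ∑ i, (Module.finrank ℂ (W i) : ℂ) *
      LinearMap.trace ℂ (W i) (ρ i g⁻¹ * fourier f (ρ i)) := by
  classical
  have h : ∀ i, LinearMap.trace ℂ (W i) (ρ i g⁻¹ * fourier f (ρ i)) =
      ∑ s, (f s : ℂ) * (ρ i).character (g⁻¹ * s) := fun i => by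
    simp [fourier, Finset.mul_sum, character]
  simp_rw [h, Finset.mul_sum]
  rw [Finset.sum_comm]
  simp_rw [mul_left_comm _ (f _ : ℂ), ← Finset.mul_sum, sum_finrank_mul_character hρ,
    inv_mul_eq_one]
  have hcard : (Fintype.card G : ℂ) ≠ 0 := Nat.cast_ne_zero.2 Fintype.card_ne_zero
  simp [hcard]

variable [MeasurableSpace G] [DiscreteMeasurableSpace G]

lemma fourier_hit_mul (p : PMF G) (hp : (transitionMatrix (walk p)).IsIrreducible)
    (σ : Representation ℂ G V) (hσ : ∑ g, σ g = 0) :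
    fourier (hit p) σ * (1 - fourier (fun g => (p g).toReal) σ) =
      -(Fintype.card G : ℂ) • (1 : Module.End ℂ V) := by
  classical
  rw [mul_sub, mul_one, ← fourier_convolution, ← fourier_sub]
  simp_rw [hit_sub_convolution p hp]
  rw [fourier_sub]
  simp [fourier, hσ, apply_ite Complex.ofReal, ite_smul]

end Transform

end HittingFourier

open HittingFourier in
theorem theorem3p5 {G : Type*} [Group G] [Fintype G]
    [MeasurableSpace G] [DiscreteMeasurableSpace G]
    (p : PMF G) (hp : (transitionMatrix (walk p)).IsIrreducible)
    {ι : Type*} [Fintype ι] [DecidableEq ι] {V : ι → Type*}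
    [∀ i, AddCommGroup (V i)] [∀ i, Module ℂ (V i)] [∀ i, FiniteDimensional ℂ (V i)]
    (ρ : ∀ i, Representation ℂ G (V i)) (hρ : IsIrrepList ρ)
    (i₁ : ι) (hi₁ : (ρ i₁).IsTrivial) :
    -- all expected hitting times are finite, and `E_x[τ_{gx}]` does not depend on `x`
    (∀ x y : G, expectedHitTime (walk p) x y ≠ ⊤) ∧
    (∀ g x : G, expectedHitTime (walk p) x (g * x) = expectedHitTime (walk p) 1 g) ∧
    -- the Fourier transform of the hitting times at the nontrivial irreducible representations
    (∀ i, i ≠ i₁ →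
      IsUnit (1 - fourier (fun g => (p g).toReal) (ρ i)) ∧
      fourier (hit p) (ρ i) =
        -(Fintype.card G : ℂ) • Ring.inverse (1 - fourier (fun g => (p g).toReal) (ρ i))) ∧
    -- the Fourier transform at the trivial representation, a scalar operator
    fourier (hit p) (ρ i₁) =
      (-∑ i ∈ Finset.univ.erase i₁,
        (Module.finrank ℂ (V i) : ℂ) * LinearMap.trace ℂ (V i) (fourier (hit p) (ρ i))) •
          (1 : Module.End ℂ (V i₁)) ∧
    -- recovery of the hitting times by Fourier inversion
    (∀ g : G, (hit p g : ℂ) =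
      (1 / (Fintype.card G : ℂ)) * ∑ i, (Module.finrank ℂ (V i) : ℂ) *
        LinearMap.trace ℂ (V i) (ρ i g⁻¹ * fourier (hit p) (ρ i))) := by

  have hinv := fun g => fourier_inversion hρ (hit p) g
  have hcard : (Fintype.card G : ℂ) ≠ 0 := Nat.cast_ne_zero.2 Fintype.card_ne_zero
  refine ⟨expectedHitTime_ne_top _ hp, fun g x => ?_, fun i hi => ?_, ?_, hinv⟩
  · simpa using expectedHitTime_walk_mul_right p 1 g x
  · have h := fourier_hit_mul p hp (ρ i) (sum_apply_eq_zero hρ hi₁ hi)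
    set A := 1 - fourier (fun g => (p g).toReal) (ρ i)
    -- In finite dimension a left inverse is enough for invertibility.
    have hA : (-(Fintype.card G : ℂ)⁻¹ • fourier (hit p) (ρ i)) * A = 1 := by
      rw [smul_mul_assoc, h, smul_smul]
      simp [hcard]
    have hu : IsUnit A := .of_mul_eq_one_right _ hA
    refine ⟨hu, ?_⟩
    rw [← mul_one (fourier (hit p) (ρ i)), ← Ring.mul_inverse_cancel A hu, ← mul_assoc, h,
      smul_mul_assoc, one_mul]
  · have := hρ.irreducible i₁
    have hd := finrank_eq_one_of_isTrivial (ρ i₁)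
    have hscal : fourier (hit p) (ρ i₁) =
        (∑ g, (hit p g : ℂ)) • (1 : Module.End ℂ (V i₁)) := by
      unfold HittingFourier.fourier
      rw [Finset.sum_smul]
      exact Finset.sum_congr rfl fun g _ => by rw [hi₁.out g]; rfl
    -- Since `h(e) = 0`, inversion at `e` says that `∑ i, d_i Tr ĥ(ρ_i)` vanishes; solve for the
    -- trivial term, where `d = 1`.
    have h := hinv 1
    simp only [hit_one, Complex.ofReal_zero, inv_one, map_one, one_mul] at h
    rw [eq_comm, mul_eq_zero, or_iff_right (one_div_ne_zero hcard),
      ← Finset.add_sum_erase _ _ (Finset.mem_univ i₁), hd, Nat.cast_one, one_mul, hscal,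
      map_smul, LinearMap.trace_one, hd, Nat.cast_one, smul_eq_mul, mul_one,
      add_eq_zero_iff_eq_neg] at h
    rw [hscal, h]
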